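/- Cameras are real $3\times 4$ matrices of rank 3, taken up to nonzero scale. The fundamental matrix $F(P_1,P_2)$ of two cameras is the $3\times 3$ matrix, up to nonzero scale, with entries $f_{il}=(-1)^{i+l}\det(\mathbf P_{1j}^T\,\mathbf P_{1k}^T\,\mathbf P_{2m}^T\,\mathbf P_{2n}^T)$, where $\mathbf P_{ar}$ is the $r$-th row of $P_a$, $\{i,j,k\}=\{l,m,n\}=\{1,2,3\}$, $j<k$ and $m<n$. Let $G$ be a finite simple undirected graph (a "viewing graph") with vertices $1,\dots,n$. $G$ is called solvable if for generic cameras $P_1,\dots,P_n$ (i.e. for all tuples of cameras at which some fixed nonzero polynomial in the $12n$ matrix entries does not vanish) the following holds: whenever cameras $P'_1,\dots,P'_n$ satisfy $F(P_i,P_j)=F(P'_i,P'_j)$ up to nonzero scale for every edge $ij$ of $G$, there are $T\in GL(4,\mathbb R)$ and nonzero scalars $\alpha_i$ with $P_i=\alpha_iP'_iT$ for all $i$. Consider graphs that carry solid undirected edges and dashed arrows, where a solid edge $i-j$ also counts as dashed arrows $i\to j$ and $j\to i$; the graph $G$ itself has solid edges only. Consider three moves, in each of which the named vertices are pairwise distinct: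 (I) if $a-b$, $b-c$, $c-d$, $d-a$ and $a-c$ are solid edges, draw the solid edge $b-d$; (II) if there are dashed arrows $a\to b$, $a\to c$ and solid edges $b-d$, $c-d$, draw the dashed arrow $a\to d$; (III) if there are dashed arrows $a\to b$, $b\to a$, and dashed arrows $x_k\to a$, $x_k\to b$ for three vertices $x_1,x_2,x_3$, make $a-b$ a solid edge. Theorem. If some finite sequence of these moves, starting from $G$, produces a graph in which every two distinct vertices are joined by a solid edge, then $G$ is solvable. -/

import Mathlib

namespace ViewingGraph

/-- A (matrix representing a) projective camera: a real `3 × 4` matrix of full rank.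
The projective camera itself is the class of the matrix up to a nonzero scalar; every notion
below is invariant under rescaling each of the matrices. -/
abbrev Camera : Type := {P : Matrix (Fin 3) (Fin 4) ℝ // P.rank = 3}

/-- Equality of two matrices as projective objects, i.e. up to a nonzero scalar. -/
def ProjEq {m n : Type*} (A B : Matrix m n ℝ) : Prop :=
  ∃ s : ℝ, s ≠ 0 ∧ A = s • B

/-- The fundamental matrix of two cameras, with entries
`f i l = (-1) ^ (i + l) * det (P₁ⱼᵀ P₁ₖᵀ P₂ₘᵀ P₂ₙᵀ)`, where `j < k` are the two row indices
different from `i`, and `m < n` are the two row indices different from `l`. -/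
noncomputable def fundamentalMatrix (P₁ P₂ : Camera) : Matrix (Fin 3) (Fin 3) ℝ :=
  Matrix.of fun i l =>
    (-1 : ℝ) ^ ((i : ℕ) + (l : ℕ)) *
      Matrix.det (Matrix.transpose (Matrix.of
        ![P₁.1 (i.succAbove 0), P₁.1 (i.succAbove 1),
          P₂.1 (l.succAbove 0), P₂.1 (l.succAbove 1)]))

variable {V : Type*}

/-- Two families of cameras are projectively equivalent (represent the same configuration) if
a single projective transformation of space takes one to the other. -/
def ProjectivelyEquivalent (P P' : V → Camera) : Prop :=
  ∃ T : Matrix.GeneralLinearGroup (Fin 4) ℝ,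
    ∀ v, ProjEq (P v).1 ((P' v).1 * (T : Matrix (Fin 4) (Fin 4) ℝ))

/-- Two families of cameras have the same fundamental matrices (up to scale) along all the
edges of `G`. -/
def SameFundamentalMatrices (G : SimpleGraph V) (P P' : V → Camera) : Prop :=
  ∀ i j, G.Adj i j → ProjEq (fundamentalMatrix (P i) (P j)) (fundamentalMatrix (P' i) (P' j))

/-- The fundamental matrices of the cameras `P` along the edges of `G` determine the
configuration of `P` among all families of cameras. -/
def SolvableAt (G : SimpleGraph V) (P : V → Camera) : Prop :=
  ∀ P' : V → Camera, SameFundamentalMatrices G P P' → ProjectivelyEquivalent P P'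

/-- A property holds for generic cameras if it holds outside a proper algebraic subset of the
space of families of camera matrices, i.e. wherever some nonzero polynomial in the matrix
entries does not vanish. -/
def ForGenericCameras (Q : (V → Camera) → Prop) : Prop :=
  ∃ p : MvPolynomial (V × Fin 3 × Fin 4) ℝ, p ≠ 0 ∧
    ∀ P : V → Camera, MvPolynomial.eval (fun x => (P x.1).1 x.2.1 x.2.2) p ≠ 0 → Q P

/-- A viewing graph is solvable if, for generic cameras, the fundamental matrices along its
edges determine the camera configuration. -/
def Solvable (G : SimpleGraph V) : Prop :=
  ForGenericCameras fun P : V → Camera => SolvableAt G P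

/-- A graph with solid (undirected) edges and dashed (directed) arrows. -/
structure AnnotatedGraph (V : Type*) where
  solid : SimpleGraph V
  dashed : V → V → Prop

namespace AnnotatedGraph

/-- A viewing graph has only solid edges. -/
def ofGraph (G : SimpleGraph V) : AnnotatedGraph V where
  solid := G
  dashed := fun _ _ => False

/-- There is a dashed arrow `i → j`; a solid edge counts as a double dashed arrow. -/
def Arrow (S : AnnotatedGraph V) (i j : V) : Prop :=
  S.solid.Adj i j ∨ S.dashed i j

/-- Draw a solid edge between `i` and `j`. -/
def addSolid (S : AnnotatedGraph V) (i j : V) : AnnotatedGraph V where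
  solid := S.solid ⊔ SimpleGraph.edge i j
  dashed := S.dashed

/-- Draw a dashed arrow from `i` to `j`. -/
def addDashed (S : AnnotatedGraph V) (i j : V) : AnnotatedGraph V where
  solid := S.solid
  dashed := fun a b => S.dashed a b ∨ (a = i ∧ b = j)

/-- A single application of one of the three moves. -/
inductive Move : AnnotatedGraph V → AnnotatedGraph V → Prop
  /-- The four-cycle `a, b, c, d` with diagonal `a, c`: draw the diagonal `b, d`. -/
  | moveI (S : AnnotatedGraph V) (a b c d : V) (hbd : b ≠ d)
      (hab : S.solid.Adj a b) (hbc : S.solid.Adj b c) (hcd : S.solid.Adj c d)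
      (hda : S.solid.Adj d a) (hac : S.solid.Adj a c) :
      Move S (S.addSolid b d)
  /-- Arrows `a → b`, `a → c` and solid edges `b, d` and `c, d`: draw the arrow `a → d`. -/
  | moveII (S : AnnotatedGraph V) (a b c d : V) (had : a ≠ d) (hbc : b ≠ c)
      (hab : S.Arrow a b) (hac : S.Arrow a c)
      (hbd : S.solid.Adj b d) (hcd : S.solid.Adj c d) :
      Move S (S.addDashed a d)
  /-- Arrows in both directions between `a` and `b`, and arrows from three further vertices
  to both `a` and `b`: draw the solid edge `a, b`. -/
  | moveIII (S : AnnotatedGraph V) (a b : V) (x : Fin 3 → V)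
      (hx : Function.Injective x) (hxa : ∀ k, x k ≠ a) (hxb : ∀ k, x k ≠ b)
      (hab : S.Arrow a b) (hba : S.Arrow b a)
      (hax : ∀ k, S.Arrow (x k) a) (hbx : ∀ k, S.Arrow (x k) b) :
      Move S (S.addSolid a b)

end AnnotatedGraph

end ViewingGraph

/-! Everything rests on one identity, `dotProduct_fundamentalMatrix`: pairing the images of `z` and
`w` through the fundamental matrix gives the volume spanned by the two centers, `z` and `w`.
Epipolar geometry thus becomes linear algebra in a basis made of centers. The invariant is `Agree`:
along solid edges `P` and `P'` share fundamental matrices, along dashed arrows they share epipoles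
(the image of one center in another camera). Each move preserves it. Move I fixes a projective frame
from the diagonal `a, c` and reconstructs `b` and `d` in it. Move II intersects two epipolar lines
(`EpipoleEq.transfer`). Move III recovers a fundamental matrix from its epipoles and three
correspondences (`projEq_fundamentalMatrix_of_epipoleEq`). On the complete graph, two cameras fix
the frame and every other camera follows (`projEq_of_fundamentalMatrix`). Only `P` is in general
position; `P'` is arbitrary, so its degeneracies have to be ruled out along the way. -/

namespace ViewingGraph
open Matrix

/-- The vector of signed maximal minors of a `3 × 4` matrix, spanning its kernel when the matrix
has full rank. -/
def center {R : Type*} [CommRing R] (P : Matrix (Fin 3) (Fin 4) R) (j : Fin 4) : R :=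
  (-1) ^ (j : ℕ) * (P.submatrix id j.succAbove).det

/-! ### Determinant identities relating cameras, centers and volumes. -/

section Identities

variable {R : Type*} [CommRing R]

theorem center_zero (P : Matrix (Fin 3) (Fin 4) R) : center P 0 =
    P 0 1 * (P 1 2 * P 2 3 - P 1 3 * P 2 2) - P 0 2 * (P 1 1 * P 2 3 - P 1 3 * P 2 1)
      + P 0 3 * (P 1 1 * P 2 2 - P 1 2 * P 2 1) := by
  simp [center, det_fin_three]
  ring

theorem center_one (P : Matrix (Fin 3) (Fin 4) R) : center P 1 =
    -(P 0 0 * (P 1 2 * P 2 3 - P 1 3 * P 2 2) - P 0 2 * (P 1 0 * P 2 3 - P 1 3 * P 2 0)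
      + P 0 3 * (P 1 0 * P 2 2 - P 1 2 * P 2 0)) := by
  simp [center, det_fin_three, Fin.succAbove, Fin.lt_def]
  ring

theorem center_two (P : Matrix (Fin 3) (Fin 4) R) : center P 2 =
    P 0 0 * (P 1 1 * P 2 3 - P 1 3 * P 2 1) - P 0 1 * (P 1 0 * P 2 3 - P 1 3 * P 2 0)
      + P 0 3 * (P 1 0 * P 2 1 - P 1 1 * P 2 0) := by
  simp [center, det_fin_three, Fin.succAbove, Fin.lt_def]
  ring

theorem center_three (P : Matrix (Fin 3) (Fin 4) R) : center P 3 =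
    -(P 0 0 * (P 1 1 * P 2 2 - P 1 2 * P 2 1) - P 0 1 * (P 1 0 * P 2 2 - P 1 2 * P 2 0)
      + P 0 2 * (P 1 0 * P 2 1 - P 1 1 * P 2 0)) := by
  simp [center, det_fin_three, Fin.succAbove, Fin.lt_def]
  ring

theorem mulVec_center (P : Matrix (Fin 3) (Fin 4) R) : P *ᵥ center P = 0 := by
  ext i
  fin_cases i <;>
  · simp [mulVec, dotProduct, Fin.sum_univ_four, center_zero, center_one, center_two,
      center_three]
    ring

/-- The determinant of four vectors in four-space. -/
def vol (x y z w : Fin 4 → R) : R := (Matrix.of ![x, y, z, w]).det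

theorem vol_eq (x y z w : Fin 4 → R) :
    vol x y z w =
      x 0 * (y 1 * (z 2 * w 3 - z 3 * w 2) - y 2 * (z 1 * w 3 - z 3 * w 1)
        + y 3 * (z 1 * w 2 - z 2 * w 1))
      - x 1 * (y 0 * (z 2 * w 3 - z 3 * w 2) - y 2 * (z 0 * w 3 - z 3 * w 0)
        + y 3 * (z 0 * w 2 - z 2 * w 0))
      + x 2 * (y 0 * (z 1 * w 3 - z 3 * w 1) - y 1 * (z 0 * w 3 - z 3 * w 0)
        + y 3 * (z 0 * w 1 - z 1 * w 0))
      - x 3 * (y 0 * (z 1 * w 2 - z 2 * w 1) - y 1 * (z 0 * w 2 - z 2 * w 0)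
        + y 2 * (z 0 * w 1 - z 1 * w 0)) := by
  rw [vol, det_succ_row_zero]
  simp only [Fin.sum_univ_four, det_fin_three, submatrix_apply]
  simp [Fin.succAbove, Fin.lt_def]
  ring

/-- Turns independence of image points into non-coplanarity of space points with the center. -/
theorem det_mulVec (P : Matrix (Fin 3) (Fin 4) R) (x y z : Fin 4 → R) :
    (Matrix.of ![P *ᵥ x, P *ᵥ y, P *ᵥ z]).det = vol (center P) x y z := by
  rw [vol_eq, det_fin_three]
  simp [mulVec, dotProduct, Fin.sum_univ_four, center_zero, center_one, center_two,
      center_three]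
  ring

end Identities

theorem fundamentalMatrix_apply (P Q : Camera) (i l : Fin 3) :
    fundamentalMatrix P Q i l = (-1 : ℝ) ^ ((i : ℕ) + (l : ℕ)) *
      vol (P.1 (i.succAbove 0)) (P.1 (i.succAbove 1))
        (Q.1 (l.succAbove 0)) (Q.1 (l.succAbove 1)) := by
  rw [fundamentalMatrix, of_apply, det_transpose, vol]

-- The pairing vanishes exactly when the two centers and the two points are coplanar, that is, on
-- the epipolar constraint.
set_option maxRecDepth 8000 in
set_option maxHeartbeats 1000000 in
theorem dotProduct_fundamentalMatrix (P Q : Camera) (z w : Fin 4 → ℝ) :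
    (P.1 *ᵥ z) ⬝ᵥ (fundamentalMatrix P Q *ᵥ (Q.1 *ᵥ w)) = vol (center Q.1) (center P.1) z w := by
  have h00 : (0 : Fin 3).succAbove (0 : Fin 2) = 1 := rfl
  have h01 : (0 : Fin 3).succAbove (1 : Fin 2) = 2 := rfl
  have h10 : (1 : Fin 3).succAbove (0 : Fin 2) = 0 := rfl
  have h11 : (1 : Fin 3).succAbove (1 : Fin 2) = 2 := rfl
  have h20 : (2 : Fin 3).succAbove (0 : Fin 2) = 0 := rfl
  have h21 : (2 : Fin 3).succAbove (1 : Fin 2) = 1 := rfl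
  simp only [mulVec, dotProduct, fundamentalMatrix_apply, vol_eq, Fin.sum_univ_four,
    Fin.sum_univ_three, center_zero, center_one, center_two, center_three,
    h00, h01, h10, h11, h20, h21, Fin.val_zero, Fin.val_one, Fin.val_two]
  ring


section LinearAlgebra

variable {x y z u : Fin 4 → ℝ}

theorem exists_combination (h : vol x y z u ≠ 0) (w : Fin 4 → ℝ) :
    ∃ α β γ δ : ℝ, w = α • x + β • y + γ • z + δ • u := by
  have hM : IsUnit (Matrix.of ![x, y, z, u]).det := isUnit_iff_ne_zero.mpr h
  have hw : (w ᵥ* (Matrix.of ![x, y, z, u])⁻¹) ᵥ* Matrix.of ![x, y, z, u] = w := by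
    rw [vecMul_vecMul, nonsing_inv_mul _ hM, vecMul_one]
  set c := w ᵥ* (Matrix.of ![x, y, z, u])⁻¹
  refine ⟨c 0, c 1, c 2, c 3, ?_⟩
  rw [← hw]
  ext i
  simp [vecMul, dotProduct, Fin.sum_univ_four]

theorem matrix_ext_of_vol {m : Type*} (h : vol x y z u ≠ 0) {A B : Matrix m (Fin 4) ℝ}
    (hx : A *ᵥ x = B *ᵥ x) (hy : A *ᵥ y = B *ᵥ y) (hz : A *ᵥ z = B *ᵥ z)
    (hu : A *ᵥ u = B *ᵥ u) : A = B := by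
  refine ext_of_mulVec_single fun i => ?_
  obtain ⟨α, β, γ, δ, hw⟩ := exists_combination h (Pi.single i 1)
  rw [hw]
  simp only [mulVec_add, mulVec_smul, hx, hy, hz, hu]

theorem exists_generalLinear {x' y' z' u' : Fin 4 → ℝ} (h : vol x y z u ≠ 0)
    (h' : vol x' y' z' u' ≠ 0) :
    ∃ T : GL (Fin 4) ℝ, T.1 *ᵥ x = x' ∧ T.1 *ᵥ y = y' ∧ T.1 *ᵥ z = z' ∧ T.1 *ᵥ u = u' := by
  have hM : IsUnit (Matrix.of ![x, y, z, u]).det := isUnit_iff_ne_zero.mpr h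
  generalize hA : Matrix.of ![x, y, z, u] = M at hM
  generalize hA' : Matrix.of ![x', y', z', u'] = M'
  have hdet : ((M⁻¹ * M')ᵀ).det ≠ 0 := by
    rw [det_transpose, det_mul, det_nonsing_inv, ← hA']
    exact mul_ne_zero (Ring.inverse_unit hM.unit ▸ Units.ne_zero _) h'
  have key : ∀ i, (M⁻¹ * M')ᵀ *ᵥ M i = M' i := by
    intro i
    have h1 : M i = Pi.single i 1 ᵥ* M := by simp [row]
    rw [mulVec_transpose, h1, vecMul_vecMul, ← Matrix.mul_assoc, mul_nonsing_inv _ hM,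
      Matrix.one_mul]
    simp [row]
  subst hA hA'
  exact ⟨GeneralLinearGroup.mkOfDetNeZero _ hdet, key 0, key 1, key 2, key 3⟩

end LinearAlgebra

/-! ### Single cameras and epipoles. -/

section Camera

variable {P Q P' Q' : Camera} {x y z u m n : Fin 4 → ℝ}

theorem Camera.exists_mulVec_eq (P : Camera) (x : Fin 3 → ℝ) : ∃ z, P.1 *ᵥ z = x := by
  have h : LinearMap.range P.1.mulVecLin = ⊤ := by
    apply Submodule.eq_top_of_finrank_eq
    rw [← Matrix.rank, P.2]
    simp
  exact LinearMap.range_eq_top.mp h x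

theorem Camera.exists_vol_ne_zero (P : Camera) : ∃ x y z, vol (center P.1) x y z ≠ 0 := by
  obtain ⟨x, hx⟩ := P.exists_mulVec_eq ![1, 0, 0]
  obtain ⟨y, hy⟩ := P.exists_mulVec_eq ![0, 1, 0]
  obtain ⟨z, hz⟩ := P.exists_mulVec_eq ![0, 0, 1]
  refine ⟨x, y, z, ?_⟩
  rw [← det_mulVec, hx, hy, hz, det_fin_three]
  simp

theorem Camera.eq_zero_of_combination (h : vol (center P.1) x y z ≠ 0) {α β γ : ℝ}
    (h0 : α • (P.1 *ᵥ x) + β • (P.1 *ᵥ y) + γ • (P.1 *ᵥ z) = 0) : α = 0 ∧ β = 0 ∧ γ = 0 := by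
  have hM : IsUnit (Matrix.of ![P.1 *ᵥ x, P.1 *ᵥ y, P.1 *ᵥ z]).det := by
    rw [det_mulVec]
    exact isUnit_iff_ne_zero.mpr h
  set M := Matrix.of ![P.1 *ᵥ x, P.1 *ᵥ y, P.1 *ᵥ z]
  have hc : ![α, β, γ] ᵥ* M = 0 := by
    rw [← h0]
    ext i
    simp [M, vecMul, dotProduct, Fin.sum_univ_three]
  have : ![α, β, γ] = 0 := by
    have := congrArg (· ᵥ* M⁻¹) hc
    simpa only [vecMul_vecMul, mul_nonsing_inv _ hM, vecMul_one, zero_vecMul] using this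
  exact ⟨congrFun this 0, congrFun this 1, congrFun this 2⟩

theorem Camera.exists_smul_center (h : P.1 *ᵥ z = 0) : ∃ t : ℝ, z = t • center P.1 := by
  obtain ⟨a, b, c, h'⟩ := P.exists_vol_ne_zero
  obtain ⟨t, α, β, γ, rfl⟩ := ViewingGraph.exists_combination h' z
  simp only [mulVec_add, mulVec_smul, mulVec_center, smul_zero, zero_add] at h
  obtain ⟨rfl, rfl, rfl⟩ := P.eq_zero_of_combination h' h
  exact ⟨t, by simp⟩

theorem ProjEq.exists_dotProduct {F F' : Matrix (Fin 3) (Fin 3) ℝ} (h : ProjEq F F') :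
    ∃ s : ℝ, s ≠ 0 ∧ ∀ x y, x ⬝ᵥ (F *ᵥ y) = s * (x ⬝ᵥ (F' *ᵥ y)) := by
  obtain ⟨s, hs, rfl⟩ := h
  exact ⟨s, hs, fun x y => by rw [smul_mulVec, dotProduct_smul, smul_eq_mul]⟩

theorem fundamentalMatrix_swap (P Q : Camera) :
    fundamentalMatrix Q P = (fundamentalMatrix P Q)ᵀ := by
  ext i l
  rw [transpose_apply, fundamentalMatrix_apply, fundamentalMatrix_apply, add_comm]
  simp only [vol_eq]
  ring

theorem ProjEq.fundamentalMatrix_swap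
    (h : ProjEq (fundamentalMatrix P Q) (fundamentalMatrix P' Q')) :
    ProjEq (fundamentalMatrix Q P) (fundamentalMatrix Q' P') := by
  obtain ⟨s, hs, h⟩ := h
  refine ⟨s, hs, ?_⟩
  rw [ViewingGraph.fundamentalMatrix_swap P, h, ViewingGraph.fundamentalMatrix_swap P',
    transpose_smul]

theorem ProjEq.symm {m n : Type*} {A B : Matrix m n ℝ} (h : ProjEq A B) : ProjEq B A := by
  obtain ⟨s, hs, rfl⟩ := h
  exact ⟨s⁻¹, inv_ne_zero hs, by rw [smul_smul, inv_mul_cancel₀ hs, one_smul]⟩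

/-- The image of the center of `P` under `Q` (an epipole) agrees, up to a nonzero scalar, with the
image of the center of `P'` under `Q'`. -/
def EpipoleEq (P Q P' Q' : Camera) : Prop :=
  ∃ t : ℝ, t ≠ 0 ∧ Q.1 *ᵥ center P.1 = t • (Q'.1 *ᵥ center P'.1)

/-- The epipole spans the right kernel of the fundamental matrix, so proportional matrices have
proportional epipoles. -/
theorem EpipoleEq.of_fundamentalMatrix (hv : vol (center P.1) (center Q.1) m n ≠ 0)
    (h : ProjEq (fundamentalMatrix P Q) (fundamentalMatrix P' Q')) : EpipoleEq P Q P' Q' := by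
  obtain ⟨s, hs, h⟩ := h.exists_dotProduct
  obtain ⟨w, hw⟩ := Q.exists_mulVec_eq (Q'.1 *ᵥ center P'.1)
  have hB : ∀ z, vol (center Q.1) (center P.1) z w = 0 := by
    intro z
    obtain ⟨z', hz'⟩ := P'.exists_mulVec_eq (P.1 *ᵥ z)
    rw [← dotProduct_fundamentalMatrix, hw, h, ← hz', dotProduct_fundamentalMatrix]
    simp only [vol_eq]
    ring_nf
  obtain ⟨α, β, γ, δ, rfl⟩ := exists_combination hv w
  have hγ : γ = 0 := by
    have h1 : γ * vol (center P.1) (center Q.1) m n = 0 := by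
      rw [← hB n]
      simp [vol_eq]
      ring
    simpa [hv] using h1
  have hδ : δ = 0 := by
    have h1 : δ * vol (center P.1) (center Q.1) m n = 0 := by
      rw [← neg_eq_zero, ← hB m]
      simp [vol_eq]
      ring
    simpa [hv] using h1
  subst hγ hδ
  simp only [mulVec_add, mulVec_smul, mulVec_center, smul_zero, zero_smul, add_zero] at hw
  -- Otherwise the centers of `P'` and `Q'` are dependent and the primed pairing is identically
  -- zero, while the unprimed one is nonzero at `m`, `n`.
  have hα : α ≠ 0 := by
    rintro rfl
    rw [zero_smul] at hw
    obtain ⟨t, ht⟩ := Camera.exists_smul_center hw.symm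
    apply hv
    obtain ⟨m', hm'⟩ := P'.exists_mulVec_eq (P.1 *ᵥ m)
    obtain ⟨n', hn'⟩ := Q'.exists_mulVec_eq (Q.1 *ᵥ n)
    have h2 := h (P.1 *ᵥ m) (Q.1 *ᵥ n)
    rw [dotProduct_fundamentalMatrix, ← hm', ← hn', dotProduct_fundamentalMatrix, ht] at h2
    have h3 : vol (center Q'.1) (t • center Q'.1) m' n' = 0 := by
      simp only [vol_eq, Pi.smul_apply, smul_eq_mul]
      ring
    rw [h3, mul_zero] at h2
    rw [← neg_eq_zero, ← h2]
    simp only [vol_eq]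
    ring
  exact ⟨α⁻¹, inv_ne_zero hα, by rw [← hw, smul_smul, inv_mul_cancel₀ hα, one_smul]⟩

end Camera

/-! ### Recovering cameras from fundamental matrices. -/

section Reconstruction

variable {P Q P' Q' : Camera} {m n : Fin 4 → ℝ}

theorem vol_swap_left {R : Type*} [CommRing R] (x y z u : Fin 4 → R) :
    vol y x z u = -vol x y z u := by
  simp only [vol_eq]
  ring

theorem vol_swap_middle {R : Type*} [CommRing R] (x y z u : Fin 4 → R) :
    vol x z y u = -vol x y z u := by
  simp only [vol_eq]
  ring

theorem vol_swap_right {R : Type*} [CommRing R] (x y z u : Fin 4 → R) :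
    vol x y u z = -vol x y z u := by
  simp only [vol_eq]
  ring

/-- A point of space can be moved along the ray of the first camera so that its image under the
second camera matches a given one up to a multiple. -/
theorem exists_corresponding_point (hv : vol (center P.1) (center Q.1) m n ≠ 0)
    (h : ProjEq (fundamentalMatrix P Q) (fundamentalMatrix P' Q')) :
    ∃ (z : Fin 4 → ℝ) (γ : ℝ), P'.1 *ᵥ z = P.1 *ᵥ m ∧ Q'.1 *ᵥ z = γ • (Q.1 *ᵥ m) := by
  obtain ⟨t, ht, hepi⟩ := EpipoleEq.of_fundamentalMatrix hv h
  obtain ⟨s, hs, h⟩ := h.exists_dotProduct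
  obtain ⟨z, hz⟩ := P'.exists_mulVec_eq (P.1 *ᵥ m)
  obtain ⟨w, hw⟩ := Q.exists_mulVec_eq (Q'.1 *ᵥ z)
  obtain ⟨α, β, γ, δ, rfl⟩ := exists_combination hv w
  have hδ : δ = 0 := by
    have h1 : vol (center Q.1) (center P.1) m
        (α • center P.1 + β • center Q.1 + γ • m + δ • n) = 0 := by
      rw [← dotProduct_fundamentalMatrix, hw, ← hz, h, dotProduct_fundamentalMatrix]
      simp only [vol_eq]
      ring_nf
    have h2 : δ * vol (center P.1) (center Q.1) m n = 0 := by
      rw [← neg_eq_zero, ← h1]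
      simp [vol_eq]
      ring
    simpa [hv] using h2
  subst hδ
  simp only [mulVec_add, mulVec_smul, mulVec_center, smul_zero, zero_smul, add_zero, hepi] at hw
  -- Sliding along the ray of `P'` cancels the epipole component in the second image.
  refine ⟨z - (α * t) • center P'.1, γ, ?_, ?_⟩
  · rw [mulVec_sub, mulVec_smul, mulVec_center, hz, smul_zero, sub_zero]
  · rw [mulVec_sub, mulVec_smul, ← hw, smul_smul, add_sub_cancel_left]

/-- The fundamental matrix determines a pair of cameras with distinct centers. -/
theorem exists_projective_of_fundamentalMatrix (hv : vol (center P.1) (center Q.1) m n ≠ 0)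
    (h : ProjEq (fundamentalMatrix P Q) (fundamentalMatrix P' Q')) :
    ∃ T : GL (Fin 4) ℝ, ProjEq P.1 (P'.1 * T.1) ∧ ProjEq Q.1 (Q'.1 * T.1) := by
  have hv' : vol (center P.1) (center Q.1) n m ≠ 0 := by rwa [vol_swap_right, neg_ne_zero]
  have hv'' : vol (center Q.1) (center P.1) m n ≠ 0 := by rwa [vol_swap_left, neg_ne_zero]
  obtain ⟨t, ht, hPQ⟩ := EpipoleEq.of_fundamentalMatrix hv h
  obtain ⟨r, hr, hQP⟩ := EpipoleEq.of_fundamentalMatrix hv'' h.fundamentalMatrix_swap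
  obtain ⟨m', γ, hPm, hQm⟩ := exists_corresponding_point hv h
  obtain ⟨n', δ, hPn, hQn⟩ := exists_corresponding_point hv' h
  obtain ⟨s, hs, h⟩ := h.exists_dotProduct
  have e1 : δ * vol (center Q.1) (center P.1) m n =
      s * vol (center Q'.1) (center P'.1) m' n' := by
    rw [← dotProduct_fundamentalMatrix P' Q', hPm, hQn, ← h, mulVec_smul, dotProduct_smul,
      dotProduct_fundamentalMatrix, smul_eq_mul]
  have e2 : γ * vol (center Q.1) (center P.1) n m =
      s * vol (center Q'.1) (center P'.1) n' m' := by
    rw [← dotProduct_fundamentalMatrix P' Q', hPn, hQm, ← h, mulVec_smul, dotProduct_smul,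
      dotProduct_fundamentalMatrix, smul_eq_mul]
  -- Swapping `m` and `n` changes the sign of both volumes, so `e1` and `e2` force equal scales.
  have hδ : δ = γ := by
    rw [vol_swap_right _ _ m, vol_swap_right _ _ m'] at e2
    have : (δ - γ) * vol (center Q.1) (center P.1) m n = 0 := by linear_combination e1 + e2
    simpa [hv'', sub_eq_zero] using this
  subst hδ
  have hδ : δ ≠ 0 := by
    rintro rfl
    rw [zero_smul] at hQm
    obtain ⟨a, rfl⟩ := Camera.exists_smul_center hQm
    rw [mulVec_smul] at hPm
    have := P.eq_zero_of_combination hv (α := -a) (β := r) (γ := 0) (by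
      rw [hQP, ← hPm]
      module)
    exact hr this.2.1
  -- These multiples of the centers are chosen so that the map `T` they define satisfies `P' T = P`
  -- and `Q' T = δ Q` on the whole basis.
  have hw : vol ((δ * t) • center P'.1) (r • center Q'.1) m' n' ≠ 0 := by
    have h1 : s * vol ((δ * t) • center P'.1) (r • center Q'.1) m' n' =
        δ * t * r * (δ * vol (center P.1) (center Q.1) m n) := by
      have h2 : vol ((δ * t) • center P'.1) (r • center Q'.1) m' n' =
          -(δ * t * r * vol (center Q'.1) (center P'.1) m' n') := by
        simp only [vol_eq, Pi.smul_apply, smul_eq_mul]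
        ring
      rw [h2, vol_swap_left (center Q.1)]
      linear_combination δ * t * r * e1
    intro h0
    rw [h0, mul_zero] at h1
    exact mul_ne_zero (mul_ne_zero (mul_ne_zero hδ ht) hr) (mul_ne_zero hδ hv) h1.symm
  obtain ⟨T, h1, h2, h3, h4⟩ := exists_generalLinear hv hw
  refine ⟨T, ⟨1, one_ne_zero, ?_⟩, ⟨δ⁻¹, inv_ne_zero hδ, ?_⟩⟩
  · rw [one_smul]
    apply matrix_ext_of_vol hv
    · rw [← mulVec_mulVec, h1, mulVec_smul, mulVec_center, mulVec_center, smul_zero]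
    · rw [← mulVec_mulVec, h2, mulVec_smul, hQP]
    · rw [← mulVec_mulVec, h3, hPm]
    · rw [← mulVec_mulVec, h4, hPn]
  · apply matrix_ext_of_vol hv
    · rw [smul_mulVec, ← mulVec_mulVec, h1, mulVec_smul, hPQ, smul_smul, ← mul_assoc,
        inv_mul_cancel₀ hδ, one_mul]
    · rw [smul_mulVec, ← mulVec_mulVec, h2, mulVec_smul, mulVec_center, mulVec_center]
      simp
    · rw [smul_mulVec, ← mulVec_mulVec, h3, hQm, smul_smul, inv_mul_cancel₀ hδ, one_smul]
    · rw [smul_mulVec, ← mulVec_mulVec, h4, hQn, smul_smul, inv_mul_cancel₀ hδ, one_smul]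

/-- If a projective transformation matches a camera `P`, then a camera `Q` is matched along the
rays of `P`, up to its epipole. -/
theorem exists_mulVec_eq_add_epipole (hv : vol (center P.1) (center Q.1) m n ≠ 0)
    (h : ProjEq (fundamentalMatrix P Q) (fundamentalMatrix P' Q')) {T : GL (Fin 4) ℝ}
    (hT : ProjEq P.1 (P'.1 * T.1)) :
    ∃ p : ℝ, p ≠ 0 ∧ ∀ z, ∃ u : ℝ,
      (Q'.1 * T.1) *ᵥ z = p • (Q.1 *ᵥ z) + u • (Q.1 *ᵥ center P.1) := by
  obtain ⟨T₁, ⟨α₁, hα₁, h₁⟩, ⟨γ, hγ, h₂⟩⟩ := exists_projective_of_fundamentalMatrix hv h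
  obtain ⟨α, hα, hT⟩ := hT
  refine ⟨γ⁻¹ * (α₁ * α⁻¹), by positivity, fun z => ?_⟩
  -- `w` is `z` carried into the frame of `T₁`, which matches both cameras; up to scale, `w` and `z`
  -- lie on the same ray of `P`.
  set w := (T₁⁻¹).1 *ᵥ (T.1 *ᵥ z) with hw
  have hTw : T₁.1 *ᵥ w = T.1 *ᵥ z := by
    rw [hw, mulVec_mulVec, ← Units.val_mul, mul_inv_cancel, Units.val_one, one_mulVec]
  have hPw : P.1 *ᵥ (w - (α₁ * α⁻¹) • z) = 0 := by
    rw [mulVec_sub, mulVec_smul]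
    nth_rw 1 [h₁]
    rw [hT, smul_mulVec, smul_mulVec, ← mulVec_mulVec, hTw, mulVec_mulVec, smul_smul, mul_assoc,
      inv_mul_cancel₀ hα, mul_one, sub_self]
  obtain ⟨t, ht⟩ := Camera.exists_smul_center hPw
  have hw' : w = (α₁ * α⁻¹) • z + t • center P.1 := by rw [← ht]; abel
  refine ⟨γ⁻¹ * t, ?_⟩
  have hQ : Q.1 *ᵥ w = γ • ((Q'.1 * T.1) *ᵥ z) := by
    rw [h₂, smul_mulVec, ← mulVec_mulVec, hTw, mulVec_mulVec]
  rw [← inv_smul_smul₀ hγ ((Q'.1 * T.1) *ᵥ z), ← hQ, hw', mulVec_add, mulVec_smul, mulVec_smul,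
    smul_add, smul_smul, smul_smul]

/-- A camera is determined by its fundamental matrices with two given cameras. -/
theorem projEq_of_fundamentalMatrix {P₁ P₂ P₃ P₁' P₂' P₃' : Camera}
    (hv : vol (center P₁.1) (center P₂.1) (center P₃.1) m ≠ 0) {T : GL (Fin 4) ℝ}
    (h₁ : ProjEq P₁.1 (P₁'.1 * T.1)) (h₂ : ProjEq P₂.1 (P₂'.1 * T.1))
    (h₁₃ : ProjEq (fundamentalMatrix P₁ P₃) (fundamentalMatrix P₁' P₃'))
    (h₂₃ : ProjEq (fundamentalMatrix P₂ P₃) (fundamentalMatrix P₂' P₃')) :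
    ProjEq P₃.1 (P₃'.1 * T.1) := by
  have hv₁ : vol (center P₁.1) (center P₃.1) (center P₂.1) m ≠ 0 := by
    rwa [vol_swap_middle, neg_ne_zero]
  have hv₂ : vol (center P₂.1) (center P₃.1) (center P₁.1) m ≠ 0 := by
    rwa [vol_swap_middle, vol_swap_left, neg_neg]
  have hv₃ : vol (center P₃.1) (center P₁.1) (center P₂.1) m ≠ 0 := by
    rwa [vol_swap_left, neg_ne_zero]
  obtain ⟨p, hp, H₁⟩ := exists_mulVec_eq_add_epipole hv₁ h₁₃ h₁
  obtain ⟨q, hq, H₂⟩ := exists_mulVec_eq_add_epipole hv₂ h₂₃ h₂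
  -- The images of `m` and of the first two centers in `P₃` are independent, so the two expansions
  -- have equal coefficients. The same independence later kills both epipole terms.
  have hpq : p = q := by
    obtain ⟨u, hu⟩ := H₁ m
    obtain ⟨w, hw⟩ := H₂ m
    have := P₃.eq_zero_of_combination hv₃ (α := u) (β := -w) (γ := p - q) (by
      rw [hu] at hw
      linear_combination (norm := module) hw)
    linarith [this.2.2]
  subst hpq
  refine ⟨p⁻¹, inv_ne_zero hp, ?_⟩
  refine ext_of_mulVec_single fun i => ?_
  obtain ⟨u, hu⟩ := H₁ (Pi.single i 1)
  obtain ⟨w, hw⟩ := H₂ (Pi.single i 1)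
  have := P₃.eq_zero_of_combination hv₃ (α := u) (β := -w) (γ := 0) (by
    rw [hu] at hw
    linear_combination (norm := module) hw)
  rw [smul_mulVec, hu, this.1, zero_smul, add_zero, inv_smul_smul₀ hp]

theorem vol_vecMul {R : Type*} [CommRing R] (T : Matrix (Fin 4) (Fin 4) R)
    (x y z u : Fin 4 → R) :
    vol (x ᵥ* T) (y ᵥ* T) (z ᵥ* T) (u ᵥ* T) = vol x y z u * T.det := by
  rw [vol, vol, ← det_mul]
  congr 1
  ext i j
  fin_cases i <;> simp [mul_apply, vecMul, dotProduct]

/-- Each entry is a volume of two rows from each camera, which explains the scale `α ^ 2 * β ^ 2 *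
det T`. -/
theorem ProjEq.fundamentalMatrix {T : GL (Fin 4) ℝ} (hP : ProjEq P.1 (P'.1 * T.1))
    (hQ : ProjEq Q.1 (Q'.1 * T.1)) :
    ProjEq (fundamentalMatrix P Q) (fundamentalMatrix P' Q') := by
  obtain ⟨α, hα, hP⟩ := hP
  obtain ⟨β, hβ, hQ⟩ := hQ
  have hdet : T.1.det ≠ 0 := T.det_ne_zero
  refine ⟨α ^ 2 * β ^ 2 * T.1.det, by positivity, ?_⟩
  have hP' : ∀ i, P.1 i = α • (P'.1 i ᵥ* T.1) := fun i => by rw [hP]; rfl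
  have hQ' : ∀ i, Q.1 i = β • (Q'.1 i ᵥ* T.1) := fun i => by rw [hQ]; rfl
  ext i l
  rw [Matrix.smul_apply, fundamentalMatrix_apply, fundamentalMatrix_apply, hP', hP', hQ', hQ']
  have hsmul : ∀ x y z u : Fin 4 → ℝ, vol (α • x) (α • y) (β • z) (β • u) =
      α ^ 2 * β ^ 2 * vol x y z u := by
    intro x y z u
    simp only [vol_eq, Pi.smul_apply, smul_eq_mul]
    ring
  rw [hsmul, vol_vecMul, smul_eq_mul]
  ring

end Reconstruction

/-! ### The geometry behind moves II and III. -/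

section Transfer

/-- Transfer of an epipole along two epipolar lines. -/
theorem EpipoleEq.transfer {A B C D A' B' C' D' : Camera}
    (hv : vol (center A.1) (center B.1) (center C.1) (center D.1) ≠ 0)
    (hAB : EpipoleEq A B A' B') (hAC : EpipoleEq A C A' C')
    (hBD : ProjEq (fundamentalMatrix B D) (fundamentalMatrix B' D'))
    (hCD : ProjEq (fundamentalMatrix C D) (fundamentalMatrix C' D')) :
    EpipoleEq A D A' D' := by
  obtain ⟨w, hw⟩ := D.exists_mulVec_eq (D'.1 *ᵥ center A'.1)
  -- Each intermediate camera confines the sought epipole to one epipolar line in `D`; the lines for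
  -- `B` and `C` meet in the epipole of `A`.
  have key : ∀ E E' : Camera, EpipoleEq A E A' E' →
      ProjEq (ViewingGraph.fundamentalMatrix E D) (ViewingGraph.fundamentalMatrix E' D') →
      vol (center D.1) (center E.1) (center A.1) w = 0 := by
    rintro E E' ⟨t, ht, hAE⟩ hED
    obtain ⟨s, hs, h⟩ := hED.exists_dotProduct
    rw [← dotProduct_fundamentalMatrix, h, hw, hAE, smul_dotProduct, dotProduct_fundamentalMatrix]
    have : vol (center D'.1) (center E'.1) (center A'.1) (center A'.1) = 0 := by
      simp only [vol_eq]
      ring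
    rw [this, smul_zero, mul_zero]
  have kB := key B B' hAB hBD
  have kC := key C C' hAC hCD
  obtain ⟨α, β, γ, δ, rfl⟩ := exists_combination hv w
  have hγ : γ = 0 := by
    have h1 : γ * vol (center A.1) (center B.1) (center C.1) (center D.1) = 0 := by
      rw [← kB]
      simp [vol_eq]
      ring
    simpa [hv] using h1
  have hβ : β = 0 := by
    have h1 : β * vol (center A.1) (center B.1) (center C.1) (center D.1) = 0 := by
      rw [← neg_eq_zero, ← kC]
      simp [vol_eq]
      ring
    simpa [hv] using h1
  subst hγ hβ
  simp only [mulVec_add, mulVec_smul, mulVec_center, smul_zero, zero_smul, add_zero] at hw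
  -- Otherwise the center of `A'` is a multiple of that of `D'`, making the epipoles of `A` and `D`
  -- in `B` dependent.
  have hα : α ≠ 0 := by
    rintro rfl
    rw [zero_smul] at hw
    obtain ⟨t, ht⟩ := Camera.exists_smul_center hw.symm
    have hvDB : vol (center D.1) (center B.1) (center A.1) (center C.1) ≠ 0 := by
      convert hv using 1
      simp only [vol_eq]
      ring
    have hvBA : vol (center B.1) (center A.1) (center D.1) (center C.1) ≠ 0 := by
      convert hv using 1
      simp only [vol_eq]
      ring
    obtain ⟨r, hr, hDB⟩ := EpipoleEq.of_fundamentalMatrix hvDB hBD.fundamentalMatrix_swap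
    obtain ⟨q, hq, hAB⟩ := hAB
    have := B.eq_zero_of_combination hvBA (α := r) (β := -(q * t)) (γ := 0) (by
      rw [hAB, hDB, ht, mulVec_smul]
      module)
    exact hr this.1
  exact ⟨α⁻¹, inv_ne_zero hα, by rw [← hw, smul_smul, inv_mul_cancel₀ hα, one_smul]⟩

theorem fundamentalMatrix_ne_zero {A B : Camera} (h : B.1 *ᵥ center A.1 ≠ 0) :
    fundamentalMatrix A B ≠ 0 := by
  intro hF
  have hvol : ∀ z w, vol (center B.1) (center A.1) z w = 0 := by
    intro z w
    rw [← dotProduct_fundamentalMatrix, hF, zero_mulVec, dotProduct_zero]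
  obtain ⟨x, y, z, hv⟩ := B.exists_vol_ne_zero
  obtain ⟨t, α, β, γ, hA⟩ := exists_combination hv (center A.1)
  have hα : α * vol (center B.1) x y z = 0 := by
    rw [← hvol y z, hA]
    simp [vol_eq]
    ring
  have hβ : β * vol (center B.1) x y z = 0 := by
    rw [← neg_eq_zero, ← hvol x z, hA]
    simp [vol_eq]
    ring
  have hγ : γ * vol (center B.1) x y z = 0 := by
    rw [← hvol x y, hA]
    simp [vol_eq]
    ring
  simp only [mul_eq_zero, hv, or_false] at hα hβ hγ
  apply h
  rw [hA, hα, hβ, hγ]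
  simp [mulVec_smul, mulVec_center]

/-- The two epipoles and three point correspondences determine the fundamental matrix. -/
theorem projEq_fundamentalMatrix_of_epipoleEq {A B A' B' : Camera} {X X' : Fin 3 → Camera}
    (h₀₁ : vol (center A.1) (center B.1) (center (X 0).1) (center (X 1).1) ≠ 0)
    (h₀₂ : vol (center A.1) (center B.1) (center (X 0).1) (center (X 2).1) ≠ 0)
    (h₁₂ : vol (center A.1) (center B.1) (center (X 1).1) (center (X 2).1) ≠ 0)
    (hAB : EpipoleEq A B A' B') (hBA : EpipoleEq B A B' A')
    (hXA : ∀ k, EpipoleEq (X k) A (X' k) A') (hXB : ∀ k, EpipoleEq (X k) B (X' k) B') :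
    ProjEq (fundamentalMatrix A B) (fundamentalMatrix A' B') := by
  have hne : fundamentalMatrix A' B' ≠ 0 := by
    apply fundamentalMatrix_ne_zero
    intro h0
    obtain ⟨t, ht, hAB⟩ := hAB
    rw [h0, smul_zero] at hAB
    have hv : vol (center B.1) (center A.1) (center (X 0).1) (center (X 1).1) ≠ 0 := by
      rwa [vol_swap_left, neg_ne_zero]
    have := B.eq_zero_of_combination hv (α := 1) (β := 0) (γ := 0) (by rw [hAB]; simp)
    exact one_ne_zero this.1
  set F' := fundamentalMatrix A' B' with hF'
  have hleft : ∀ y, (A.1 *ᵥ center B.1) ⬝ᵥ (F' *ᵥ y) = 0 := by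
    intro y
    obtain ⟨t, ht, hBA⟩ := hBA
    obtain ⟨w, rfl⟩ := B'.exists_mulVec_eq y
    rw [hBA, smul_dotProduct, dotProduct_fundamentalMatrix]
    have : vol (center B'.1) (center A'.1) (center B'.1) w = 0 := by
      simp only [vol_eq]
      ring
    rw [this, smul_zero]
  have hright : ∀ x, x ⬝ᵥ (F' *ᵥ (B.1 *ᵥ center A.1)) = 0 := by
    intro x
    obtain ⟨t, ht, hAB⟩ := hAB
    obtain ⟨w, rfl⟩ := A'.exists_mulVec_eq x
    rw [hAB, mulVec_smul, dotProduct_smul, dotProduct_fundamentalMatrix]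
    have : vol (center B'.1) (center A'.1) w (center A'.1) = 0 := by
      simp only [vol_eq]
      ring
    rw [this, smul_zero]
  have hdiag : ∀ k, (A.1 *ᵥ center (X k).1) ⬝ᵥ (F' *ᵥ (B.1 *ᵥ center (X k).1)) = 0 := by
    intro k
    obtain ⟨t, ht, hA⟩ := hXA k
    obtain ⟨r, hr, hB⟩ := hXB k
    rw [hA, hB, mulVec_smul, dotProduct_smul, smul_dotProduct, dotProduct_fundamentalMatrix]
    have : ∀ z, vol (center B'.1) (center A'.1) z z = 0 := by
      intro z
      simp only [vol_eq]
      ring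
    rw [this, smul_zero, smul_zero]
  set g := (A.1 *ᵥ center (X 0).1) ⬝ᵥ (F' *ᵥ (B.1 *ᵥ center (X 1).1)) with hg
  -- Expand the third center in the basis of the other four: the epipole directions drop out, and
  -- the third correspondence makes the form antisymmetric on the remaining plane.
  have hanti : (A.1 *ᵥ center (X 1).1) ⬝ᵥ (F' *ᵥ (B.1 *ᵥ center (X 0).1)) = -g := by
    obtain ⟨α, β, γ, δ, hX⟩ := exists_combination h₀₁ (center (X 2).1)
    have hγ : γ ≠ 0 := by
      rintro rfl
      apply h₁₂
      rw [hX]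
      simp only [vol_eq, Pi.add_apply, Pi.smul_apply, smul_eq_mul]
      ring
    have hδ : δ ≠ 0 := by
      rintro rfl
      apply h₀₂
      rw [hX]
      simp only [vol_eq, Pi.add_apply, Pi.smul_apply, smul_eq_mul]
      ring
    have h2 := hdiag 2
    rw [hX] at h2
    simp only [mulVec_add, mulVec_smul, mulVec_center, add_dotProduct, dotProduct_add,
      smul_dotProduct, dotProduct_smul, hleft, hright, hdiag, smul_eq_mul, mul_zero, zero_add,
      add_zero, smul_zero, ← hg] at h2
    have h3 : γ * δ * ((A.1 *ᵥ center (X 1).1) ⬝ᵥ (F' *ᵥ (B.1 *ᵥ center (X 0).1)) + g) = 0 := by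
      linear_combination h2
    rcases mul_eq_zero.mp h3 with h3 | h3
    · exact absurd h3 (mul_ne_zero hγ hδ)
    · linarith
  set v := vol (center B.1) (center A.1) (center (X 0).1) (center (X 1).1) with hv_def
  have hv : v ≠ 0 := by rwa [hv_def, vol_swap_left, neg_ne_zero]
  -- Antisymmetric forms on a plane are proportional; `g` may be zero here, which is excluded below
  -- because `F'` is nonzero.
  have hform : ∀ x y, x ⬝ᵥ (F' *ᵥ y) = g / v * (x ⬝ᵥ (fundamentalMatrix A B *ᵥ y)) := by
    intro x y
    obtain ⟨z, rfl⟩ := A.exists_mulVec_eq x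
    obtain ⟨w, rfl⟩ := B.exists_mulVec_eq y
    rw [dotProduct_fundamentalMatrix]
    obtain ⟨α, β, γ, δ, rfl⟩ := exists_combination h₀₁ z
    obtain ⟨α', β', γ', δ', rfl⟩ := exists_combination h₀₁ w
    have hvol : vol (center B.1) (center A.1)
        (α • center A.1 + β • center B.1 + γ • center (X 0).1 + δ • center (X 1).1)
        (α' • center A.1 + β' • center B.1 + γ' • center (X 0).1 + δ' • center (X 1).1) =
        (γ * δ' - δ * γ') * v := by
      simp only [hv_def, vol_eq, Pi.add_apply, Pi.smul_apply, smul_eq_mul]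
      ring
    rw [hvol]
    simp only [mulVec_add, mulVec_smul, mulVec_center, add_dotProduct, dotProduct_add,
      smul_dotProduct, dotProduct_smul, hleft, hright, hdiag, hanti, smul_eq_mul, mul_zero,
      zero_add, add_zero, smul_zero, ← hg]
    field_simp
    ring
  have hF : F' = (g / v) • fundamentalMatrix A B := by
    ext i j
    have := hform (Pi.single i 1) (Pi.single j 1)
    simpa using this
  have hgv : g / v ≠ 0 := by
    intro h0
    rw [h0, zero_smul] at hF
    exact hne hF
  exact ProjEq.symm ⟨g / v, hgv, hF⟩

end Transfer

/-- Serves the one-vertex graph, which has no pair of cameras to fix a frame. -/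
theorem Camera.exists_projective (P P' : Camera) :
    ∃ T : GL (Fin 4) ℝ, ProjEq P.1 (P'.1 * T.1) := by
  obtain ⟨x, y, z, hv⟩ := P.exists_vol_ne_zero
  obtain ⟨x', hx⟩ := P'.exists_mulVec_eq (P.1 *ᵥ x)
  obtain ⟨y', hy⟩ := P'.exists_mulVec_eq (P.1 *ᵥ y)
  obtain ⟨z', hz⟩ := P'.exists_mulVec_eq (P.1 *ᵥ z)
  have hv' : vol (center P'.1) x' y' z' ≠ 0 := by
    rwa [← det_mulVec, hx, hy, hz, det_mulVec]
  obtain ⟨T, h1, h2, h3, h4⟩ := exists_generalLinear hv hv'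
  refine ⟨T, 1, one_ne_zero, ?_⟩
  rw [one_smul]
  apply matrix_ext_of_vol hv <;> rw [← mulVec_mulVec]
  · rw [h1, mulVec_center, mulVec_center]
  · rw [h2, hx]
  · rw [h3, hy]
  · rw [h4, hz]

/-! ### General position is a generic condition. -/

section GeneralPosition

variable {V : Type*} {R : Type*} [CommRing R]

/-- The centers of a family of cameras, together with two points of the moment curve. -/
def markedPoint (t : Fin 2 → R) (M : V → Matrix (Fin 3) (Fin 4) R) : V ⊕ Fin 2 → Fin 4 → R :=
  Sum.elim (fun v => center (M v)) fun k i => t k ^ (i : ℕ)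

theorem map_vol {S : Type*} [CommRing S] (φ : R →+* S) (x y z u : Fin 4 → R) :
    φ (vol x y z u) = vol (φ ∘ x) (φ ∘ y) (φ ∘ z) (φ ∘ u) := by
  simp only [vol_eq, map_add, map_sub, map_mul, Function.comp_apply]

theorem map_markedPoint {S : Type*} [CommRing S] (φ : R →+* S) (t : Fin 2 → R)
    (M : V → Matrix (Fin 3) (Fin 4) R) (w : V ⊕ Fin 2) :
    φ ∘ markedPoint t M w = markedPoint (φ ∘ t) (fun v => (M v).map φ) w := by
  cases w with
  | inl v =>
    ext j
    simp only [markedPoint, Sum.elim_inl, Function.comp_apply, center, map_mul, map_pow, map_neg,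
      map_one, RingHom.map_det]
    rfl
  | inr k =>
    ext j
    simp [markedPoint]

/-- Any four of the centers and the two marked points of the moment curve are not coplanar. -/
def InGeneralPosition (t : Fin 2 → R) (M : V → Matrix (Fin 3) (Fin 4) R) : Prop :=
  ∀ f : Fin 4 ↪ V ⊕ Fin 2, vol (markedPoint t M (f 0)) (markedPoint t M (f 1))
    (markedPoint t M (f 2)) (markedPoint t M (f 3)) ≠ 0

/-- A matrix with center on the moment curve. -/
def momentMatrix (s : R) : Matrix (Fin 3) (Fin 4) R :=
  !![-s, 1, 0, 0; 0, -s, 1, 0; 0, 0, -s, 1]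

theorem center_momentMatrix (s : R) : center (momentMatrix s) = fun i : Fin 4 => s ^ (i : ℕ) := by
  ext i
  fin_cases i
  · simp [center_zero, momentMatrix]
  · simp [center_one, momentMatrix]
  · simp [center_two, momentMatrix]
    ring
  · simp [center_three, momentMatrix]
    ring

/-- Distinct points of the moment curve give a nonzero Vandermonde determinant. -/
theorem inGeneralPosition_momentMatrix [IsDomain R] {τ : V ⊕ Fin 2 → R}
    (hτ : Function.Injective τ) :
    InGeneralPosition (fun k => τ (.inr k)) fun v => momentMatrix (τ (.inl v)) := by
  have hpt : ∀ w, markedPoint (fun k => τ (.inr k)) (fun v => momentMatrix (τ (.inl v))) w =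
      fun i : Fin 4 => τ w ^ (i : ℕ) := by
    rintro (v | k)
    · exact center_momentMatrix _
    · rfl
  intro f
  simp only [hpt]
  have hdet : (vandermonde fun i => τ (f i)).det ≠ 0 :=
    det_vandermonde_ne_zero_iff.mpr (hτ.comp f.injective)
  convert hdet using 1
  rw [vol]
  congr 1
  ext i j
  fin_cases i <;> rfl

theorem forGenericCameras_inGeneralPosition [Finite V] : ∃ t : Fin 2 → ℝ,
    ForGenericCameras fun P : V → Camera => InGeneralPosition t fun v => (P v).1 := by
  classical
  have := Fintype.ofFinite V
  obtain ⟨τ, hτ⟩ : ∃ τ : V ⊕ Fin 2 → ℝ, Function.Injective τ := by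
    obtain ⟨g, hg⟩ := Countable.exists_injective_nat (V ⊕ Fin 2)
    exact ⟨fun w => (g w : ℝ), Nat.cast_injective.comp hg⟩
  set t : Fin 2 → ℝ := fun k => τ (.inr k)
  set X : V → Matrix (Fin 3) (Fin 4) (MvPolynomial (V × Fin 3 × Fin 4) ℝ) :=
    fun v => Matrix.of fun i j => MvPolynomial.X (v, i, j)
  set q := markedPoint (MvPolynomial.C ∘ t) X
  set p := ∏ f : Fin 4 ↪ V ⊕ Fin 2, vol (q (f 0)) (q (f 1)) (q (f 2)) (q (f 3))
  have heval : ∀ M : V → Matrix (Fin 3) (Fin 4) ℝ,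
      MvPolynomial.eval (fun x => M x.1 x.2.1 x.2.2) p ≠ 0 ↔ InGeneralPosition t M := by
    intro M
    have hq : ∀ w, MvPolynomial.eval (fun x => M x.1 x.2.1 x.2.2) ∘ q w = markedPoint t M w := by
      intro w
      rw [map_markedPoint]
      congr 1
      · ext k
        simp
      · ext v i j
        simp [X]
    rw [map_prod, Finset.prod_ne_zero_iff]
    simp only [Finset.mem_univ, true_imp_iff, map_vol, hq, InGeneralPosition]
  refine ⟨t, p, ?_, fun P hP => (heval _).mp hP⟩
  intro hp
  -- A nonzero value at moment matrices shows `p ≠ 0`; since `heval` covers arbitrary matrices,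
  -- their rank is irrelevant.
  refine (heval fun v => momentMatrix (τ (.inl v))).mpr (inGeneralPosition_momentMatrix hτ) ?_
  rw [hp, map_zero]

variable {t : Fin 2 → R} {M : V → Matrix (Fin 3) (Fin 4) R}

theorem InGeneralPosition.four (h : InGeneralPosition t M) {a b c d : V} (hab : a ≠ b)
    (hac : a ≠ c) (had : a ≠ d) (hbc : b ≠ c) (hbd : b ≠ d) (hcd : c ≠ d) :
    vol (center (M a)) (center (M b)) (center (M c)) (center (M d)) ≠ 0 :=
  h ⟨![.inl a, .inl b, .inl c, .inl d], by
    intro i j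
    fin_cases i <;> fin_cases j <;> simp [hab, hac, had, hbc, hbd, hcd, hab.symm, hac.symm,
      had.symm, hbc.symm, hbd.symm, hcd.symm]⟩

/-- The marked points fill the slots left by missing centers, so graphs with fewer than four
vertices are covered too. -/
theorem InGeneralPosition.three (h : InGeneralPosition t M) {a b c : V} (hab : a ≠ b)
    (hac : a ≠ c) (hbc : b ≠ c) :
    ∃ m, vol (center (M a)) (center (M b)) (center (M c)) m ≠ 0 :=
  ⟨_, h ⟨![.inl a, .inl b, .inl c, .inr 0], by
    intro i j
    fin_cases i <;> fin_cases j <;> simp [hab, hac, hbc, hab.symm, hac.symm, hbc.symm]⟩⟩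

theorem InGeneralPosition.two (h : InGeneralPosition t M) {a b : V} (hab : a ≠ b) :
    ∃ m n, vol (center (M a)) (center (M b)) m n ≠ 0 :=
  ⟨_, _, h ⟨![.inl a, .inl b, .inr 0, .inr 1], by
    intro i j
    fin_cases i <;> fin_cases j <;> simp [hab, hab.symm]⟩⟩

end GeneralPosition

/-! ### Invariance under the moves, and the complete graph. -/

section Moves

variable {V : Type*} {P P' : V → Camera} {t : Fin 2 → ℝ}

/-- The fundamental matrices along the solid edges and the epipoles along the dashed arrows of
`S` agree for two families of cameras. -/
structure Agree (S : AnnotatedGraph V) (P P' : V → Camera) : Prop where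
  solid : SameFundamentalMatrices S.solid P P'
  dashed : ∀ i j, S.dashed i j → i ≠ j ∧ EpipoleEq (P i) (P j) (P' i) (P' j)

theorem Agree.arrow {S : AnnotatedGraph V} (hS : Agree S P P')
    (hP : InGeneralPosition t fun v => (P v).1) {i j : V} (hij : S.Arrow i j) :
    i ≠ j ∧ EpipoleEq (P i) (P j) (P' i) (P' j) := by
  rcases hij with hij | hij
  · obtain ⟨m, n, hv⟩ := hP.two hij.ne
    exact ⟨hij.ne, EpipoleEq.of_fundamentalMatrix hv (hS.solid i j hij)⟩
  · exact hS.dashed i j hij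

theorem Agree.addSolid {S : AnnotatedGraph V} (hS : Agree S P P') {i j : V}
    (hij : ProjEq (fundamentalMatrix (P i) (P j)) (fundamentalMatrix (P' i) (P' j))) :
    Agree (S.addSolid i j) P P' := by
  refine ⟨fun a b hab => ?_, hS.dashed⟩
  rcases hab with hab | hab
  · exact hS.solid a b hab
  · rw [SimpleGraph.edge_adj] at hab
    rcases hab.1 with ⟨rfl, rfl⟩ | ⟨rfl, rfl⟩
    · exact hij
    · exact hij.fundamentalMatrix_swap

theorem Agree.move {S S' : AnnotatedGraph V} (hS : Agree S P P')
    (hP : InGeneralPosition t fun v => (P v).1) (h : AnnotatedGraph.Move S S') : Agree S' P P' := by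
  cases h with
  | moveI a b c d hbd hab hbc hcd hda hac =>
    apply hS.addSolid
    obtain ⟨m, n, hv⟩ := hP.two hac.ne
    obtain ⟨T, hTa, hTc⟩ := exists_projective_of_fundamentalMatrix hv (hS.solid a c hac)
    -- In the frame fixed by `a` and `c`, any common neighbor of both is determined; apply this to
    -- `b` and `d`.
    have hT : ∀ e, S.solid.Adj a e → S.solid.Adj c e → ProjEq (P e).1 ((P' e).1 * T.1) := by
      intro e hae hce
      obtain ⟨m, hv⟩ := hP.three hac.ne hae.ne hce.ne
      exact projEq_of_fundamentalMatrix hv hTa hTc (hS.solid a e hae) (hS.solid c e hce)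
    exact (hT b hab hbc.symm).fundamentalMatrix (hT d hda.symm hcd)
  | moveII a b c d had hbc hab hac hbd hcd =>
    refine ⟨hS.solid, fun i j hij => ?_⟩
    rcases hij with hij | ⟨rfl, rfl⟩
    · exact hS.dashed i j hij
    · obtain ⟨hab', hAB⟩ := hS.arrow hP hab
      obtain ⟨hac', hAC⟩ := hS.arrow hP hac
      exact ⟨had, hAB.transfer (hP.four hab' hac' had hbc hbd.ne hcd.ne) hAC
        (hS.solid _ _ hbd) (hS.solid _ _ hcd)⟩
  | moveIII a b x hx hxa hxb hab hba hax hbx =>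
    apply hS.addSolid
    obtain ⟨hab', hAB⟩ := hS.arrow hP hab
    have hv : ∀ k l, k ≠ l → vol (center (P a).1) (center (P b).1) (center (P (x k)).1)
        (center (P (x l)).1) ≠ 0 := fun k l hkl =>
      hP.four hab' (hxa k).symm (hxa l).symm (hxb k).symm (hxb l).symm (hx.ne hkl)
    exact projEq_fundamentalMatrix_of_epipoleEq (X := fun k => P (x k)) (X' := fun k => P' (x k))
      (hv 0 1 (by decide)) (hv 0 2 (by decide)) (hv 1 2 (by decide)) hAB (hS.arrow hP hba).2
      (fun k => (hS.arrow hP (hax k)).2) (fun k => (hS.arrow hP (hbx k)).2)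

theorem solvableAt_top (hP : InGeneralPosition t fun v => (P v).1) :
    SolvableAt (⊤ : SimpleGraph V) P := by
  intro P' h
  rcases subsingleton_or_nontrivial V with hV | hV
  · rcases isEmpty_or_nonempty V with hV' | ⟨⟨a⟩⟩
    · exact ⟨1, fun v => hV'.elim v⟩
    · obtain ⟨T, hT⟩ := (P a).exists_projective (P' a)
      exact ⟨T, fun v => by rwa [Subsingleton.elim v a]⟩
  · obtain ⟨a, b, hab⟩ := exists_pair_ne V
    obtain ⟨m, n, hv⟩ := hP.two hab
    obtain ⟨T, hTa, hTb⟩ := exists_projective_of_fundamentalMatrix hv (h a b hab)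
    refine ⟨T, fun v => ?_⟩
    rcases eq_or_ne a v with rfl | hav
    · exact hTa
    rcases eq_or_ne b v with rfl | hbv
    · exact hTb
    obtain ⟨m, hv⟩ := hP.three hab hav hbv
    exact projEq_of_fundamentalMatrix hv hTa hTb (h a v hav) (h b v hbv)

end Moves
end ViewingGraph

theorem theorem3 {V : Type*} [Finite V] (G : SimpleGraph V)
    (S : ViewingGraph.AnnotatedGraph V)
    (hmoves : Relation.ReflTransGen ViewingGraph.AnnotatedGraph.Move
      (ViewingGraph.AnnotatedGraph.ofGraph G) S)
    (hcomplete : S.solid = ⊤) :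
    ViewingGraph.Solvable G := by
  obtain ⟨t, p, hp, hgeneric⟩ := ViewingGraph.forGenericCameras_inGeneralPosition (V := V)
  refine ⟨p, hp, fun P hP P' hG => ?_⟩
  have hpos := hgeneric P hP
  have hS : ViewingGraph.Agree S P P' := by
    clear hcomplete
    induction hmoves with
    | refl => exact ⟨hG, fun _ _ h => h.elim⟩
    | tail _ hmove ih => exact ih.move hpos hmove
  exact ViewingGraph.solvableAt_top hpos P' (hcomplete ▸ hS.solid)
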